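/- \textbf{Model.} A scrip system consists of a finite set $V$ of $m$ agents, a finite set $\Sigma$ of service types, a set $\mathcal T\subseteq V\times\Sigma$ of demand types $\tau=(j,\sigma)$ (requestor $j$, requested service $\sigma$), for each $\tau=(j,\sigma)\in\mathcal T$ a nonempty set $\mathcal D(\tau)\subseteq V\setminus\{j\}$ of compatible providers, a probability distribution $\boldsymbol\phi=(\phi_\tau)_{\tau\in\mathcal T}$, and payoffs $w_\tau=w_{j\sigma}\in\mathbb R$, scaled so that $\max_{\tau\in\mathcal T}|w_\tau|=1$. There are $K$ scrips; a state is a vector $\mathbf q\in\Omega_K=\{\mathbf q\in\mathbb Z_{\ge0}^V:\sum_i q_i=K\}$. In each period $t=0,1,2,\dots$ one request arises, of a type $\tau=(j,\sigma)$ drawn independently of the past from $\boldsymbol\phi$. The planner observes it and either rejects it (payoff $v[t]=0$, state unchanged) or, if $q_j[t]>0$, lets some $k\in\mathcal D(\tau)$ serve it (payoff $v[t]=w_\tau$, and $\mathbf q[t+1]=\mathbf q[t]-\mathbf e_j+\mathbf e_k$). A feasible policy makes this decision, possibly at random, as a function of the states and demand types observed so far. For a policy $\pi$ let $$W^\pi_T=\min_{\mathbf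 q\in\Omega_K}\frac1T\sum_{t=0}^{T-1}\mathbb E\big[v^\pi[t]\,\big|\,\mathbf q[0]=\mathbf q\big],\qquad W^*_T=\sup_{\pi}\max_{\mathbf q\in\Omega_K}\frac1T\sum_{t=0}^{T-1}\mathbb E\big[v^\pi[t]\,\big|\,\mathbf q[0]=\mathbf q\big],$$ the supremum being over all feasible policies, and let $W^\pi=\liminf_{T\to\infty}W^\pi_T$, $W^*=\limsup_{T\to\infty}W^*_T$, $L^\pi_T=W^*_T-W^\pi_T$ and $L^\pi=W^*-W^\pi$. The connectedness of the system is $$\alpha=\min_{\emptyset\ne A\subsetneq V}\ \sum\big\{\phi_\tau:\ \tau=(j,\sigma)\in\mathcal T,\ j\in A,\ \mathcal D(\tau)\not\subseteq A\big\}.$$ \textbf{MBP rule.} Let $\bar q_i=\dfrac{q_i+\sqrt K}{K+m\sqrt K}$ and $f(x)=-\sqrt m\,x^{-1/2}$. When a request of type $\tau=(j,\sigma)$ arises in period $t$, admit it if and only if $$w_\tau+f(\bar q_j[t])-\min_{k\in\mathcal D(\tau)}f(\bar q_k[t])\ge0\quad\text{and}\quad q_j[t]>0;$$ if it is admitted,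 it is served by some $k^*\in\operatorname{argmin}_{k\in\mathcal D(\tau)}f(\bar q_k[t])$, i.e. a compatible agent with the fewest scrips, ties being broken arbitrarily. \textbf{Corollary.} There are a universal constant $C>0$ and a polynomial $P$ in two variables such that, for every scrip system with $\alpha>0$ and every integer $K\ge K_1:=P(m,1/\alpha)$, the MBP rule satisfies $$L^{\mathrm{MBP}}_T\le Cm\,\frac KT+Cm^2\,\frac1K\quad\text{for all integers }T\ge1,\qquad\text{and}\qquad L^{\mathrm{MBP}}\le Cm^2\,\frac1K.$$ -/

import Mathlib

open Filter

noncomputable section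

namespace Scrip

/-- The state space `Ω_K`: allocations of `K` indistinguishable scrips to the agents in `V`. -/
@[ext]
structure State (V : Type*) [Fintype V] (K : ℕ) where
  count : V → ℕ
  total : ∑ i, count i = K

instance State.instFinite {V : Type*} [Fintype V] (K : ℕ) : Finite (State V K) := by
  classical
  refine Finite.of_injective
    (fun q : State V K => fun i : V =>
      (⟨q.count i, Nat.lt_succ_of_le ((Finset.single_le_sum
        (fun _ _ => Nat.zero_le _) (Finset.mem_univ i)).trans_eq q.total)⟩ : Fin (K + 1))) ?_
  intro q q' h
  ext i
  simpa using congrFun h i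

instance State.instFintype {V : Type*} [Fintype V] (K : ℕ) : Fintype (State V K) :=
  Fintype.ofFinite _

/-- Agent `j` gives one scrip to agent `k` (nothing happens if `j` has no scrip):
`q ↦ q - e_j + e_k`. -/
def State.move {V : Type*} [Fintype V] [DecidableEq V] {K : ℕ} (q : State V K) (j k : V) :
    State V K :=
  if h : 0 < q.count j then
    { count := fun i => q.count i - (Pi.single j 1 : V → ℕ) i + (Pi.single k 1 : V → ℕ) i
      total := by
        have h1 : ∑ i, (q.count i - (Pi.single j 1 : V → ℕ) i) +
            ∑ i, (Pi.single j 1 : V → ℕ) i = K := by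
          rw [← Finset.sum_add_distrib]
          refine (Finset.sum_congr rfl fun i _ => Nat.sub_add_cancel ?_).trans q.total
          by_cases hij : i = j
          · subst hij
            simpa [Nat.succ_le_iff] using h
          · simp [hij]
        rw [Finset.sum_add_distrib]
        simpa using h1 }
  else q

/-- The primitives of a scrip system with agents `V` and service types `S`. A demand type is a
pair (requestor, requested service); `providers τ` is the set of agents who are compatible with
(can serve) `τ`, never including the requestor; `arrival` is the distribution of the demand type
that arises in each period; `payoff τ` is generated whenever a request of type `τ` is served. -/
structure System (V S : Type*) where
  types : Finset (V × S)
  providers : types → Finset V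
  providers_nonempty : ∀ τ, (providers τ).Nonempty
  requestor_notMem : ∀ τ : types, τ.1.1 ∉ providers τ
  arrival : PMF types
  payoff : types → ℝ

namespace System

variable {V S : Type*}

/-- The agent who makes a request of type `τ`. -/
def requestor (M : System V S) (τ : M.types) : V := τ.1.1

/-- The connectedness `α(φ, P, D)`, where `P(τ)` consists of the requestor of `τ` only: the
minimum over nonempty proper subsets `A` of the agents of the arrival probability of the demand
types with requestor in `A` and some compatible provider outside `A`. -/
def connectedness [Fintype V] [DecidableEq V] (M : System V S) : ℝ :=
  ⨅ A : {A : Finset V // A.Nonempty ∧ A ≠ Finset.univ},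
    ∑ τ : M.types with M.requestor τ ∈ A.1 ∧ ∃ k ∈ M.providers τ, k ∉ A.1,
      (M.arrival τ).toReal

/-- What happened in periods `0, …, t - 1`: the state and the demand type in each of them. -/
abbrev History [Fintype V] (M : System V S) (K t : ℕ) : Type _ :=
  Fin t → State V K × M.types

/-- A feasible (possibly randomized) policy. In period `t`, given the history and the current
state and demand type, it specifies the distribution of the decision: `none` rejects the request,
`some k` lets agent `k` serve it. A request can be served only by a compatible provider, and only
if the requestor has a scrip. -/
structure Policy [Fintype V] (M : System V S) (K : ℕ) where
  decision : (t : ℕ) → M.History K t → State V K → M.types → PMF (Option V)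
  feasible : ∀ t h q τ k, some k ∈ (decision t h q τ).support →
    k ∈ M.providers τ ∧ 0 < q.count (M.requestor τ)

/-- The payoff collected for a decision on a request of type `τ`. -/
def reward (M : System V S) (τ : M.types) : Option V → ℝ
  | none => 0
  | some _ => M.payoff τ

/-- The state after a decision on a request of type `τ`: if agent `k` serves the request then the
requestor gives a scrip to `k`. -/
def nextState [Fintype V] [DecidableEq V] (M : System V S) {K : ℕ} (q : State V K)
    (τ : M.types) : Option V → State V K
  | none => q
  | some k => q.move (M.requestor τ) k

section Dynamics

variable [Fintype V] [DecidableEq V] {M : System V S} {K : ℕ}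

/-- Given the joint law of the history and the state at the start of period `t`, the joint law of
these together with the demand type (independent of the past) and the decision in period `t`. -/
def periodLaw (π : M.Policy K) (t : ℕ) (p : PMF (M.History K t × State V K)) :
    PMF ((M.History K t × State V K) × M.types × Option V) :=
  p.bind fun x => M.arrival.bind fun τ => (π.decision t x.1 x.2 τ).map fun a => (x, τ, a)

/-- The joint law of the history and the state at the start of period `t` under the policy `π`
when the initial state is `q₀`. -/
def stateLaw (π : M.Policy K) (q₀ : State V K) : (t : ℕ) → PMF (M.History K t × State V K)
  | 0 => PMF.pure (Fin.elim0, q₀)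
  | t + 1 => (periodLaw π t (stateLaw π q₀ t)).map fun x =>
      (Fin.snoc x.1.1 (x.1.2, x.2.1), M.nextState x.1.2 x.2.1 x.2.2)

/-- `E[v^π[t] | q[0] = q₀]`, the expected payoff collected in period `t`. -/
def expectedPayoff (π : M.Policy K) (q₀ : State V K) (t : ℕ) : ℝ :=
  ∑ x : (M.History K t × State V K) × M.types × Option V,
    (periodLaw π t (stateLaw π q₀ t) x).toReal * M.reward x.2.1 x.2.2

/-- The expected average payoff per period in the first `T` periods, from initial state `q₀`. -/
def averagePayoff (π : M.Policy K) (T : ℕ) (q₀ : State V K) : ℝ :=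
  (1 / (T : ℝ)) * ∑ t ∈ Finset.range T, expectedPayoff π q₀ t

/-- `W^π_T`: worst case over the initial state. -/
def finitePayoff (π : M.Policy K) (T : ℕ) : ℝ :=
  ⨅ q₀ : State V K, averagePayoff π T q₀

/-- `W^*_T`: supremum over feasible policies, best initial state. -/
def optFinitePayoff (M : System V S) (K T : ℕ) : ℝ :=
  ⨆ π : M.Policy K, ⨆ q₀ : State V K, averagePayoff π T q₀

/-- `W^π`. -/
def longRunPayoff (π : M.Policy K) : ℝ :=
  liminf (fun T : ℕ => finitePayoff π T) atTop

/-- `W^*`. -/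
def optLongRunPayoff (M : System V S) (K : ℕ) : ℝ :=
  limsup (fun T : ℕ => optFinitePayoff M K T) atTop

/-- The transient optimality gap `L^π_T`. -/
def finiteLoss (π : M.Policy K) (T : ℕ) : ℝ :=
  optFinitePayoff M K T - finitePayoff π T

/-- The long-run optimality gap `L^π`. -/
def longRunLoss (π : M.Policy K) : ℝ :=
  optLongRunPayoff M K - longRunPayoff π

end Dynamics

end System

/-- The normalized number of scrips `q̄_i = (q_i + √K) / (K + m √K)`. -/
def State.normalized {V : Type*} [Fintype V] {K : ℕ} (q : State V K) (i : V) : ℝ :=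
  ((q.count i : ℝ) + √(K : ℝ)) / ((K : ℝ) + (Fintype.card V : ℝ) * √(K : ℝ))

/-- The congestion function `f(x) = -√m · x ^ (-1/2)`. -/
def congestion (m : ℕ) (x : ℝ) : ℝ :=
  -√(m : ℝ) * x ^ (-(1 / 2) : ℝ)

/-- The congestion cost `f(q̄_i)` of agent `i` in state `q`. -/
def State.cost {V : Type*} [Fintype V] {K : ℕ} (q : State V K) (i : V) : ℝ :=
  congestion (Fintype.card V) (q.normalized i)

namespace System

variable {V S : Type*} [Fintype V] {M : System V S} {K : ℕ}

/-- `min_{k ∈ D(τ)} f(q̄_k)`. -/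
def minCost (M : System V S) (q : State V K) (τ : M.types) : ℝ :=
  (M.providers τ).inf' (M.providers_nonempty τ) q.cost

open Classical in
/-- `π` follows the mirror backpressure admission-and-provider-selection rule: the request is
admitted if and only if its score is nonnegative and the requestor has a scrip; it is then served
by a compatible agent of least congestion cost, ties being broken in any way. -/
def Policy.IsMBP (π : M.Policy K) : Prop :=
  ∀ t h q τ, ∃ k ∈ M.providers τ, q.cost k = M.minCost q τ ∧
    π.decision t h q τ = PMF.pure
      (if 0 ≤ M.payoff τ + q.cost (M.requestor τ) - M.minCost q τ ∧ 0 < q.count (M.requestor τ)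
        then some k else none)

/-- The rule can be followed. -/
theorem Policy.exists_isMBP (M : System V S) (K : ℕ) : ∃ π : M.Policy K, π.IsMBP := by
  classical
  have hk : ∀ (q : State V K) (τ : M.types), ∃ k ∈ M.providers τ, q.cost k = M.minCost q τ := by
    intro q τ
    obtain ⟨k, hk, h⟩ := Finset.exists_mem_eq_inf' (M.providers_nonempty τ) q.cost
    exact ⟨k, hk, h.symm⟩
  choose sel hsel hmin using hk
  refine ⟨⟨fun _ _ q τ => PMF.pure
    (if 0 ≤ M.payoff τ + q.cost (M.requestor τ) - M.minCost q τ ∧ 0 < q.count (M.requestor τ)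
        then some (sel q τ) else none), ?_⟩, ?_⟩
  · intro t h q τ k hk
    rw [PMF.support_pure, Set.mem_singleton_iff] at hk
    split_ifs at hk with hc
    · obtain rfl := Option.some.inj hk
      exact ⟨hsel q τ, hc.2⟩
  · intro t h q τ
    refine ⟨sel q τ, hsel q τ, hmin q τ, ?_⟩
    congr

end System

end Scrip

end

noncomputable section

namespace Scrip

/-! The benchmark is the Lagrangian dual: with a price `y i` on each agent's scrips, `dualValue` is
the expected best value of payoff plus price change when the requestor need not own a scrip.

Upper bound: the linear potential `∑ i, y i * q i` bounds every policy's average payoff by the dual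
value plus a boundary term of order spread times `K / T`. Since `|w| ≤ 1`, price gaps beyond one can
be shortened without raising the dual value (`exists_compresses`), so a spread of at most `m`
suffices.

Lower bound: the costs are the gradient of `mirror`, so MBP earns the dual value at its current
costs minus two losses: second-order terms, and scores of requests whose requestor has no scrip
(`score_sub_le_of_isMBP`). If the poorest agent's cost is moderate, nobody is empty and the
second-order loss is `O(m² / K)`. Otherwise the costs are widely spread, and connectedness makes the
dual value exceed its infimum by enough to absorb both losses (`iInf_dualValue_add_le`,
`iInf_dualValue_le_cost`). -/

/-- Expectation of a real function under a probability mass function on a finite type. -/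
def expect {α : Type*} [Fintype α] (p : PMF α) (f : α → ℝ) : ℝ := ∑ a, (p a).toReal * f a

/-! ### Expectations over finite types -/

section expect

variable {α β : Type*} [Fintype α] [Fintype β]

theorem sum_toReal_pmf (p : PMF α) : ∑ a, (p a).toReal = 1 := by
  have h := p.tsum_coe
  rw [tsum_fintype] at h
  rw [← ENNReal.toReal_sum fun a _ => p.apply_ne_top a, h, ENNReal.toReal_one]

theorem expect_const (p : PMF α) (c : ℝ) : expect p (fun _ => c) = c := by
  rw [expect, ← Finset.sum_mul, sum_toReal_pmf, one_mul]

theorem expect_add (p : PMF α) (f g : α → ℝ) :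
    expect p (fun a => f a + g a) = expect p f + expect p g := by
  simp only [expect, mul_add, Finset.sum_add_distrib]

theorem expect_sub (p : PMF α) (f g : α → ℝ) :
    expect p (fun a => f a - g a) = expect p f - expect p g := by
  simp only [expect, mul_sub, Finset.sum_sub_distrib]

theorem expect_mono_of_support (p : PMF α) {f g : α → ℝ} (h : ∀ a ∈ p.support, f a ≤ g a) :
    expect p f ≤ expect p g := by
  refine Finset.sum_le_sum fun a _ => ?_
  by_cases ha : p a = 0
  · simp [ha]
  · exact mul_le_mul_of_nonneg_left (h a ((p.mem_support_iff a).2 ha)) ENNReal.toReal_nonneg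

theorem expect_mono (p : PMF α) {f g : α → ℝ} (h : ∀ a, f a ≤ g a) : expect p f ≤ expect p g :=
  expect_mono_of_support p fun a _ => h a

theorem expect_pure (a : α) (f : α → ℝ) : expect (PMF.pure a) f = f a := by
  classical
  rw [expect, Finset.sum_eq_single a]
  · simp
  · intro b _ hb
    simp [PMF.pure_apply, hb]
  · simp

theorem expect_bind (p : PMF α) (k : α → PMF β) (f : β → ℝ) :
    expect (p.bind k) f = expect p fun a => expect (k a) f := by
  have h : ∀ b, ((p.bind k) b).toReal = ∑ a, (p a).toReal * (k a b).toReal := by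
    intro b
    rw [PMF.bind_apply, tsum_fintype, ENNReal.toReal_sum fun a _ =>
      ENNReal.mul_ne_top (p.apply_ne_top a) ((k a).apply_ne_top b)]
    simp [ENNReal.toReal_mul]
  simp only [expect, h, Finset.sum_mul, Finset.mul_sum]
  rw [Finset.sum_comm]
  simp only [mul_assoc]

theorem expect_map (p : PMF α) (k : α → β) (f : β → ℝ) :
    expect (p.map k) f = expect p fun a => f (k a) := by
  rw [← PMF.bind_pure_comp, expect_bind]
  simp [expect_pure]

end expect

/-! ### The dual function and the drift of a potential -/

namespace System

variable {V S : Type*} {M : System V S}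

/-- The score of a request of type `τ` at dual prices `y`. -/
def score (M : System V S) (y : V → ℝ) (τ : M.types) : ℝ :=
  max 0 (M.payoff τ + y (M.requestor τ) - (M.providers τ).inf' (M.providers_nonempty τ) y)

/-- The dual objective at prices `y`. -/
def dualValue (M : System V S) (y : V → ℝ) : ℝ := expect M.arrival (M.score y)

/-- `z` is a contraction of `y` that keeps the order and distances up to one. -/
def Compresses (y z : V → ℝ) : Prop :=
  ∀ i k, y k ≤ y i → z i - z k ≤ y i - y k ∧ min 1 (y i - y k) ≤ z i - z k

/-- A nonnegative difference between requestor and provider can only shrink. A negative one either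
does not increase or becomes at most `-1`; in the latter case the score vanishes because payoffs are
at most one. -/
theorem score_le_of_compresses {y z : V → ℝ} (h : Compresses y z) (τ : M.types)
    (hw : |M.payoff τ| ≤ 1) : M.score z τ ≤ M.score y τ := by
  obtain ⟨k, hk, hz⟩ := Finset.exists_mem_eq_inf' (M.providers_nonempty τ) z
  have hy := Finset.inf'_le y hk
  rw [abs_le] at hw
  rw [score, score, hz]
  refine max_le (le_max_left _ _) ?_
  rcases le_total (y k) (y (M.requestor τ)) with hle | hle
  · refine le_max_of_le_right ?_
    linarith [(h _ _ hle).1]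
  · have h2 := (h _ _ hle).2
    rcases min_choice 1 (y k - y (M.requestor τ)) with h3 | h3
    · refine le_max_of_le_left ?_
      linarith
    · refine le_max_of_le_right ?_
      linarith

theorem dualValue_nonneg (M : System V S) (y : V → ℝ) : 0 ≤ M.dualValue y := by
  rw [dualValue, ← expect_const M.arrival 0]
  exact expect_mono _ fun τ => le_max_left _ _

variable [Fintype V] {K : ℕ}

theorem expect_periodLaw (π : M.Policy K) (t : ℕ) (p : PMF (M.History K t × State V K))
    (f : (M.History K t × State V K) × M.types × Option V → ℝ) :
    expect (periodLaw π t p) f = expect p fun x => expect M.arrival fun τ =>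
      expect (π.decision t x.1 x.2 τ) fun a => f (x, τ, a) := by
  simp only [periodLaw, expect_bind, expect_map]

variable [DecidableEq V]

theorem expectedPayoff_eq (π : M.Policy K) (q₀ : State V K) (t : ℕ) :
    expectedPayoff π q₀ t = expect (stateLaw π q₀ t) fun x => expect M.arrival fun τ =>
      expect (π.decision t x.1 x.2 τ) fun a => M.reward τ a :=
  expect_periodLaw π t (stateLaw π q₀ t) fun x => M.reward x.2.1 x.2.2

theorem expect_stateLaw_succ (π : M.Policy K) (q₀ : State V K) (t : ℕ) (Φ : State V K → ℝ) :
    (expect (stateLaw π q₀ (t + 1)) fun x => Φ x.2) =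
      expect (stateLaw π q₀ t) fun x => expect M.arrival fun τ =>
        expect (π.decision t x.1 x.2 τ) fun a => Φ (M.nextState x.2 τ a) := by
  rw [stateLaw, expect_map, expect_periodLaw]

/-- The expected payoff of a period, corrected by the drift of a potential `Φ`. -/
theorem expectedPayoff_sub_drift (π : M.Policy K) (q₀ : State V K) (t : ℕ) (Φ : State V K → ℝ) :
    expectedPayoff π q₀ t + (expect (stateLaw π q₀ t) fun x => Φ x.2) -
        (expect (stateLaw π q₀ (t + 1)) fun x => Φ x.2) =
      expect (stateLaw π q₀ t) fun x => expect M.arrival fun τ =>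
        expect (π.decision t x.1 x.2 τ) fun a =>
          M.reward τ a + Φ x.2 - Φ (M.nextState x.2 τ a) := by
  rw [expectedPayoff_eq, expect_stateLaw_succ]
  simp only [expect_sub, expect_add, expect_const]

/-- The drifts of the potential telescope, leaving only its initial and final values. -/
theorem sum_expectedPayoff_drift (π : M.Policy K) (q₀ : State V K) (Φ : State V K → ℝ) (T : ℕ) :
    ∑ t ∈ Finset.range T, expectedPayoff π q₀ t =
      (∑ t ∈ Finset.range T, expect (stateLaw π q₀ t) fun x => expect M.arrival fun τ =>
        expect (π.decision t x.1 x.2 τ) fun a =>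
          M.reward τ a + Φ x.2 - Φ (M.nextState x.2 τ a)) +
      ((expect (stateLaw π q₀ T) fun x => Φ x.2) - Φ q₀) := by
  have h := Finset.sum_range_sub (fun t => expect (stateLaw π q₀ t) fun x => Φ x.2) T
  have h0 : (expect (stateLaw π q₀ 0) fun x => Φ x.2) = Φ q₀ := by rw [stateLaw, expect_pure]
  rw [h0] at h
  rw [← h, ← Finset.sum_add_distrib]
  refine Finset.sum_congr rfl fun t _ => ?_
  rw [← expectedPayoff_sub_drift]
  ring

/-- If the drift-corrected payoff is at most `c` in every period, then so is the average payoff,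
up to the variation of the potential. -/
theorem averagePayoff_le_of_drift (π : M.Policy K) (q₀ : State V K) (Φ : State V K → ℝ)
    {c d : ℝ} {T : ℕ} (hT : 1 ≤ T)
    (hc : ∀ t h q, (expect M.arrival fun τ => expect (π.decision t h q τ) fun a =>
      M.reward τ a + Φ q - Φ (M.nextState q τ a)) ≤ c)
    (hd : ∀ q q', Φ q - Φ q' ≤ d) : averagePayoff π T q₀ ≤ c + d / T := by
  have hT' : (0 : ℝ) < T := by exact_mod_cast hT
  have h1 : (expect (stateLaw π q₀ T) fun x => Φ x.2) - Φ q₀ ≤ d := by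
    rw [← expect_const (stateLaw π q₀ T) (Φ q₀), ← expect_sub, ← expect_const (stateLaw π q₀ T) d]
    exact expect_mono _ fun x => by simpa [expect_const] using hd x.2 q₀
  have h2 : (∑ t ∈ Finset.range T, expect (stateLaw π q₀ t) fun x => expect M.arrival fun τ =>
        expect (π.decision t x.1 x.2 τ) fun a =>
          M.reward τ a + Φ x.2 - Φ (M.nextState x.2 τ a)) ≤ T * c := by
    refine (Finset.sum_le_card_nsmul _ _ c fun t _ => ?_).trans (by simp)
    rw [← expect_const (stateLaw π q₀ t) c]
    exact expect_mono _ fun x => by simpa [expect_const] using hc t x.1 x.2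
  rw [averagePayoff, sum_expectedPayoff_drift π q₀ Φ]
  calc _ ≤ (1 / (T : ℝ)) * (T * c + d) := by gcongr
    _ = c + d / T := by field_simp

theorem le_averagePayoff_of_drift (π : M.Policy K) (q₀ : State V K) (Φ : State V K → ℝ)
    {c d : ℝ} {T : ℕ} (hT : 1 ≤ T)
    (hc : ∀ t h q, c ≤ (expect M.arrival fun τ => expect (π.decision t h q τ) fun a =>
      M.reward τ a + Φ q - Φ (M.nextState q τ a)))
    (hd : ∀ q q', Φ q - Φ q' ≤ d) : c - d / T ≤ averagePayoff π T q₀ := by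
  have hT' : (0 : ℝ) < T := by exact_mod_cast hT
  have h1 : -d ≤ (expect (stateLaw π q₀ T) fun x => Φ x.2) - Φ q₀ := by
    rw [← expect_const (stateLaw π q₀ T) (Φ q₀), ← expect_sub,
      ← expect_const (stateLaw π q₀ T) (-d)]
    refine expect_mono _ fun x => ?_
    linarith [hd q₀ x.2]
  have h2 : T * c ≤ (∑ t ∈ Finset.range T, expect (stateLaw π q₀ t) fun x =>
      expect M.arrival fun τ => expect (π.decision t x.1 x.2 τ) fun a =>
          M.reward τ a + Φ x.2 - Φ (M.nextState x.2 τ a)) := by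
    refine le_trans (by simp) (Finset.card_nsmul_le_sum _ _ c fun t _ => ?_)
    rw [← expect_const (stateLaw π q₀ t) c]
    exact expect_mono _ fun x => by simpa [expect_const] using hc t x.1 x.2
  rw [averagePayoff, sum_expectedPayoff_drift π q₀ Φ]
  calc c - d / T = (1 / (T : ℝ)) * (T * c + -d) := by field_simp; ring
    _ ≤ _ := by gcongr

/-- Separating prices across a wide gap costs at least the connectedness. -/
theorem dualValue_gap (hw : ∀ τ, |M.payoff τ| ≤ 1) (y : V → ℝ)
    {p δ : ℝ} (hδ : 0 ≤ δ)
    (hgap : ∀ i, p < y i ∨ y i + (δ + 1) ≤ p) {a b : V} (ha : p < y a) (hb : y b ≤ p) :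
    ∃ z, M.dualValue z + M.connectedness * δ ≤ M.dualValue y := by
  classical
  let A : Finset V := Finset.univ.filter fun i => p < y i
  have hA : A.Nonempty ∧ A ≠ Finset.univ :=
    ⟨⟨a, by simp [A, ha]⟩, fun h => by
      have := h ▸ Finset.mem_univ b
      simp [A] at this
      linarith⟩
  -- Closing the gap by `δ` leaves a distance above one across it, so `z` still compresses `y`.
  let z : V → ℝ := fun i => if p < y i then y i - δ else y i
  have hz : Compresses y z := by
    intro i k hik
    simp only [z]
    split_ifs with h1 h2 h2
    · exact ⟨by linarith, (min_le_right _ _).trans (by linarith)⟩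
    · have := (hgap k).resolve_left h2
      exact ⟨by linarith, (min_le_left _ _).trans (by linarith)⟩
    · linarith
    · exact ⟨by linarith, (min_le_right _ _).trans (by linarith)⟩
  refine ⟨z, ?_⟩
  have hcut : M.connectedness ≤
      ∑ τ : M.types with M.requestor τ ∈ A ∧ ∃ k ∈ M.providers τ, k ∉ A,
        (M.arrival τ).toReal := by
    have := ciInf_le (f := fun A : {A : Finset V // A.Nonempty ∧ A ≠ Finset.univ} =>
      ∑ τ : M.types with M.requestor τ ∈ A.1 ∧ ∃ k ∈ M.providers τ, k ∉ A.1,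
        (M.arrival τ).toReal) (Set.finite_range _).bddBelow ⟨A, hA⟩
    refine le_trans (le_of_eq ?_) (this.trans (le_of_eq ?_))
    · rfl
    · simp only
  have hstep : ∀ τ, M.score z τ + (if M.requestor τ ∈ A ∧ ∃ k ∈ M.providers τ, k ∉ A
      then δ else 0) ≤ M.score y τ := by
    intro τ
    split_ifs with hτ
    · obtain ⟨hj, k₀, hk₀, hk₀A⟩ := hτ
      obtain ⟨k, hk, hzk⟩ := Finset.exists_mem_eq_inf' (M.providers_nonempty τ) z
      have hy := Finset.inf'_le y hk
      have hle : z k ≤ z k₀ := hzk ▸ Finset.inf'_le z hk₀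
      have hj' : p < y (M.requestor τ) := by simpa [A] using hj
      have hk₀' : ¬ p < y k₀ := by simpa [A] using hk₀A
      have hg₀ := (hgap k₀).resolve_left hk₀'
      -- Lowered prices stay above `p - δ`, while `k₀` is at most `p - δ - 1`: the cheapest provider
      -- under `z` lies below the gap.
      have hk' : ¬ p < y k := by
        intro hpk
        simp only [z, if_pos hpk, if_neg hk₀'] at hle
        linarith
      have hg := (hgap k).resolve_left hk'
      have hwτ := abs_le.1 (hw τ)
      rw [score, score, hzk]
      simp only [z, if_pos hj', if_neg hk']
      -- The distance left across the gap outweighs any payoff `≥ -1`, so the score under `z` is not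
      -- truncated and the whole drop `δ` counts.
      rw [max_eq_right (by linarith)]
      exact le_max_of_le_right (by linarith)
    · rw [add_zero]
      exact score_le_of_compresses hz τ (hw τ)
  have h1 := expect_mono M.arrival hstep
  rw [expect_add] at h1
  have h2 : M.connectedness * δ ≤ expect M.arrival fun τ =>
      (if M.requestor τ ∈ A ∧ ∃ k ∈ M.providers τ, k ∉ A then δ else 0) := by
    refine (mul_le_mul_of_nonneg_right hcut hδ).trans (le_of_eq ?_)
    rw [expect, Finset.sum_mul, Finset.sum_filter]
    refine Finset.sum_congr rfl fun τ _ => ?_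
    split_ifs <;> simp
  exact (add_le_add_right h2 _).trans h1

end System

/-! ### Gaps and compressions of finitely many reals, by Lebesgue measure -/

open MeasureTheory in
theorem volume_iUnion_Ico_le {V : Type*} [Fintype V] (y : V → ℝ) (δ : ℝ) :
    volume (⋃ i, Set.Ico (y i) (y i + δ)) ≤ ENNReal.ofReal (Fintype.card V * δ) := by
  refine (measure_iUnion_fintype_le _ _).trans (le_of_eq ?_)
  simp [Real.volume_Ico, ENNReal.ofReal_mul]

open MeasureTheory in
/-- Among finitely many reals of large spread, there is a wide gap. -/
theorem exists_gap {V : Type*} [Fintype V] (y : V → ℝ) {δ : ℝ} (hδ : 0 ≤ δ) (a b : V)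
    (h : Fintype.card V * δ < y a - y b) :
    ∃ p, y b ≤ p ∧ p < y a ∧ ∀ i, p < y i ∨ y i + δ ≤ p := by
  by_contra hcon
  push Not at hcon
  -- Without a gap, `m` intervals of length `δ` would cover one of length greater than `m * δ`.
  have hsub : Set.Ico (y b) (y a) ⊆ ⋃ i, Set.Ico (y i) (y i + δ) := by
    intro p hp
    obtain ⟨i, h1, h2⟩ := hcon p hp.1 hp.2
    exact Set.mem_iUnion.2 ⟨i, h1, h2⟩
  have h1 := (measure_mono hsub).trans (volume_iUnion_Ico_le y δ)
  rw [Real.volume_Ico, ENNReal.ofReal_le_ofReal_iff (by positivity)] at h1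
  linarith

-- The new price is the length of the part of `U` below `y i`: stretches further than one above the
-- nearest price below are deleted. The total length of `U` bounds the spread.
open MeasureTheory in
theorem exists_compresses {V : Type*} [Fintype V] (y : V → ℝ) :
    ∃ z : V → ℝ, System.Compresses y z ∧ ∀ i k, z i - z k ≤ Fintype.card V := by
  let U : Set ℝ := ⋃ i, Set.Ico (y i) (y i + 1)
  have hU : volume U ≤ ENNReal.ofReal (Fintype.card V) := by
    simpa using volume_iUnion_Ico_le y 1
  have hfin : volume U ≠ ⊤ := ne_top_of_le_ne_top ENNReal.ofReal_ne_top hU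
  have hUr : volume.real U ≤ Fintype.card V :=
    ENNReal.toReal_le_of_le_ofReal (by positivity) hU
  refine ⟨fun i => volume.real (U ∩ Set.Iio (y i)), ?_, ?_⟩
  · intro i k hik
    have hsplit : volume.real (U ∩ Set.Iio (y i)) =
        volume.real (U ∩ Set.Iio (y k)) + volume.real (U ∩ Set.Ico (y k) (y i)) := by
      rw [← measureReal_union _ (MeasurableSet.inter
        (MeasurableSet.iUnion fun _ => measurableSet_Ico) measurableSet_Ico)
        (measure_ne_top_of_subset Set.inter_subset_left hfin)
        (measure_ne_top_of_subset Set.inter_subset_left hfin), ← Set.inter_union_distrib_left,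
        Set.Iio_union_Ico_eq_Iio hik]
      exact Set.disjoint_left.2 fun x hx hx' => absurd hx.2 (not_lt.2 hx'.2.1)
    have hup : volume.real (U ∩ Set.Ico (y k) (y i)) ≤ y i - y k := by
      refine (measureReal_mono Set.inter_subset_right (by simp)).trans (le_of_eq ?_)
      rw [Real.volume_real_Ico_of_le hik]
    have hlow : min 1 (y i - y k) ≤ volume.real (U ∩ Set.Ico (y k) (y i)) := by
      have hsub : Set.Ico (y k) (min (y k + 1) (y i)) ⊆ U ∩ Set.Ico (y k) (y i) := fun x hx =>
        ⟨Set.mem_iUnion.2 ⟨k, hx.1, hx.2.trans_le (min_le_left _ _)⟩, hx.1,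
          hx.2.trans_le (min_le_right _ _)⟩
      refine le_trans (le_of_eq ?_) (measureReal_mono hsub
        (measure_ne_top_of_subset Set.inter_subset_left hfin))
      rw [Real.volume_real_Ico_of_le (le_min (by linarith) hik), ← min_sub_sub_right]
      simp
    constructor <;> simp only [hsplit] <;> linarith
  · intro i k
    have h1 : volume.real (U ∩ Set.Iio (y i)) ≤ volume.real U :=
      measureReal_mono Set.inter_subset_left hfin
    have h2 : 0 ≤ volume.real (U ∩ Set.Iio (y k)) := measureReal_nonneg
    simp only
    linarith

end Scrip

/-! ### Transfers of scrips and weak duality -/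

namespace Scrip

theorem State.count_move {V : Type*} [Fintype V] [DecidableEq V] {K : ℕ} (q : State V K) {j k : V}
    (hj : 0 < q.count j) (i : V) : (q.move j k).count i =
      q.count i - (Pi.single j 1 : V → ℕ) i + (Pi.single k 1 : V → ℕ) i := by
  rw [State.move, dif_pos hj]

/-- The effect of a transfer on a separable function of the state. -/
theorem State.sum_move {V : Type*} [Fintype V] [DecidableEq V] {K : ℕ} (q : State V K) {j k : V}
    (hjk : k ≠ j) (hj : 0 < q.count j) (g : V → ℕ → ℝ) :
    ∑ i, g i ((q.move j k).count i) = ∑ i, g i (q.count i) +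
      (g j (q.count j - 1) - g j (q.count j)) + (g k (q.count k + 1) - g k (q.count k)) := by
  have h : ∀ i, g i ((q.move j k).count i) = g i (q.count i) +
      (if i = j then g j (q.count j - 1) - g j (q.count j) else 0) +
      (if i = k then g k (q.count k + 1) - g k (q.count k) else 0) := by
    intro i
    rw [q.count_move hj]
    by_cases hij : i = j
    · subst hij
      simp [hjk.symm]
    · by_cases hik : i = k
      · subst hik
        simp [hij]
      · simp [hij, hik]
  simp only [h, Finset.sum_add_distrib, Finset.sum_ite_eq', Finset.mem_univ, if_true]

theorem State.sum_count_real {V : Type*} [Fintype V] {K : ℕ} (q : State V K) :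
    ∑ i, (q.count i : ℝ) = K := by
  exact_mod_cast q.total

namespace System

variable {V S : Type*} {M : System V S}

theorem provider_ne (τ : M.types) {k : V} (hk : k ∈ M.providers τ) : k ≠ M.requestor τ := by
  rintro rfl
  exact M.requestor_notMem τ hk

theorem iInf_dualValue_le (M : System V S) (y : V → ℝ) : (⨅ y, M.dualValue y) ≤ M.dualValue y :=
  ciInf_le ⟨0, by rintro _ ⟨y, rfl⟩; exact M.dualValue_nonneg y⟩ y

variable [Fintype V] [DecidableEq V] {K : ℕ}

/-- Weak duality, over a finite horizon. -/
theorem averagePayoff_le_dualValue (π : M.Policy K) (q₀ : State V K) {T : ℕ} (hT : 1 ≤ T)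
    (z : V → ℝ) {d : ℝ} (hz : ∀ i k, z i - z k ≤ d) :
    averagePayoff π T q₀ ≤ M.dualValue z + d * K / T := by
  refine averagePayoff_le_of_drift π q₀ (fun q => ∑ i, z i * q.count i) hT ?_ ?_
  · intro t h q
    refine expect_mono _ fun τ => ?_
    rw [← expect_const (π.decision t h q τ) (M.score z τ)]
    refine expect_mono_of_support _ fun a ha => ?_
    cases a with
    | none => simp [reward, nextState, score]
    | some k =>
      obtain ⟨hk, hq⟩ := π.feasible t h q τ k ha
      have hmv := q.sum_move (provider_ne τ hk) hq fun i n => z i * n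
      rw [Nat.cast_sub hq] at hmv
      push_cast at hmv
      simp only [reward, nextState, score]
      refine le_max_of_le_right ?_
      rw [hmv]
      linarith [Finset.inf'_le z hk]
  · intro q q'
    rcases isEmpty_or_nonempty V with hV | hV
    · have := q.total
      simp at this
      simp [← this]
    obtain ⟨b, hb⟩ := Finite.exists_min z
    have h1 : ∑ i, z i * q.count i ≤ ∑ i, (z b + d) * (q.count i : ℝ) :=
      Finset.sum_le_sum fun i _ =>
        mul_le_mul_of_nonneg_right (by linarith [hz i b]) (Nat.cast_nonneg _)
    have h2 : ∑ i, z b * (q'.count i : ℝ) ≤ ∑ i, z i * q'.count i :=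
      Finset.sum_le_sum fun i _ => mul_le_mul_of_nonneg_right (hb i) (Nat.cast_nonneg _)
    rw [← Finset.mul_sum, State.sum_count_real] at h1 h2
    linarith

/-- Each `y` is compressed before weak duality is applied, so the transient term is uniform in `y`
and no minimizer is needed. -/
theorem averagePayoff_le_iInf_dualValue (hw : ∀ τ, |M.payoff τ| ≤ 1) (π : M.Policy K)
    (q₀ : State V K) {T : ℕ} (hT : 1 ≤ T) :
    averagePayoff π T q₀ ≤ (⨅ y, M.dualValue y) + Fintype.card V * K / T := by
  rw [← sub_le_iff_le_add]
  refine le_ciInf fun y => ?_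
  obtain ⟨z, hz, hd⟩ := exists_compresses y
  have h1 := averagePayoff_le_dualValue π q₀ hT z hd
  have h2 : M.dualValue z ≤ M.dualValue y :=
    expect_mono _ fun τ => score_le_of_compresses hz τ (hw τ)
  linarith

theorem iInf_dualValue_add_le (hw : ∀ τ, |M.payoff τ| ≤ 1) (y : V → ℝ)
    {δ : ℝ} (hδ : 0 ≤ δ) (a b : V) (h : Fintype.card V * (δ + 1) < y a - y b) :
    (⨅ y, M.dualValue y) + M.connectedness * δ ≤ M.dualValue y := by
  obtain ⟨p, hb, ha, hp⟩ := exists_gap y (by linarith) a b h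
  obtain ⟨z, hz⟩ := dualValue_gap hw y hδ hp ha hb
  linarith [M.iInf_dualValue_le z]

theorem connectedness_le_one (τ : M.types) : M.connectedness ≤ 1 := by
  classical
  obtain ⟨k, hk⟩ := M.providers_nonempty τ
  have hA : ({M.requestor τ} : Finset V).Nonempty ∧ ({M.requestor τ} : Finset V) ≠ Finset.univ :=
    ⟨by simp, fun h => by
      have hmem := Finset.mem_univ k
      rw [← h, Finset.mem_singleton] at hmem
      exact provider_ne τ hk hmem⟩
  rw [connectedness]
  refine (ciInf_le (Set.finite_range _).bddBelow ⟨_, hA⟩).trans ?_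
  rw [← sum_toReal_pmf M.arrival]
  exact Finset.sum_le_sum_of_subset_of_nonneg (Finset.filter_subset _ _)
    fun _ _ _ => ENNReal.toReal_nonneg

end System

/-! ### The mirror potential -/

theorem two_mul_sqrt_sub_sqrt_sub_one_le {x : ℝ} (hx : 1 ≤ x) :
    2 * (√x - √(x - 1)) ≤ 1 / √x + 1 / (x * √x) := by
  have ha : 0 < √x := Real.sqrt_pos.2 (by linarith)
  have hb : 0 ≤ √(x - 1) := Real.sqrt_nonneg _
  have ha2 : √x ^ 2 = x := Real.sq_sqrt (by linarith)
  have hb2 : √(x - 1) ^ 2 = x - 1 := Real.sq_sqrt (by linarith)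
  have hle : √(x - 1) ≤ √x := Real.sqrt_le_sqrt (by linarith)
  have hd1 : (√x - √(x - 1)) * √x ≤ 1 := by nlinarith
  have hx' : 1 / √x + 1 / (x * √x) = (x + 1) / (x * √x) := by field_simp
  rw [hx', le_div_iff₀ (by positivity)]
  set a := √x
  set b := √(x - 1)
  have hd0 : 0 ≤ (a - b) * a := mul_nonneg (by linarith) ha.le
  have hsq : ((a - b) * a) ^ 2 ≤ 1 := by nlinarith
  -- As `a² - b² = 1`, one has `2a(a - b) = 1 + (a - b)²`; multiply by `a² = x`.
  have key : 2 * (a - b) * (x * a) = x + ((a - b) * a) ^ 2 := by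
    have hb2' : b ^ 2 = a ^ 2 - 1 := by linarith
    rw [← ha2]
    linear_combination (-a ^ 2) * hb2'
  linarith

theorem le_two_mul_sqrt_add_one_sub_sqrt {x : ℝ} (hx : 0 < x) :
    1 / √x - 1 / (x * √x) ≤ 2 * (√(x + 1) - √x) := by
  have ha : 0 < √x := Real.sqrt_pos.2 hx
  have ha2 : √x ^ 2 = x := Real.sq_sqrt hx.le
  have hb2 : √(x + 1) ^ 2 = x + 1 := Real.sq_sqrt (by linarith)
  have hle : √x ≤ √(x + 1) := Real.sqrt_le_sqrt (by linarith)
  have hx' : 1 / √x - 1 / (x * √x) = (x - 1) / (x * √x) := by field_simp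
  rw [hx', div_le_iff₀ (by positivity)]
  set a := √x
  set b := √(x + 1)
  have hd1 : (b - a) * a ≤ 1 := by nlinarith
  have hd0 : 0 ≤ (b - a) * a := mul_nonneg (by linarith) ha.le
  have hsq : ((b - a) * a) ^ 2 ≤ 1 := by nlinarith
  have key : 2 * (b - a) * (x * a) = x - ((b - a) * a) ^ 2 := by
    have hb2' : b ^ 2 = a ^ 2 + 1 := by linarith
    rw [← ha2]
    linear_combination a ^ 2 * hb2'
  linarith

/-- The total mass `K + m √K` of the shifted scrip counts. -/
def shiftedMass (V : Type*) [Fintype V] (K : ℕ) : ℝ := (K : ℝ) + (Fintype.card V : ℝ) * √(K : ℝ)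

namespace State

variable {V : Type*} [Fintype V] {K : ℕ}

/-- The shifted scrip count `q_i + √K`. -/
def shifted (q : State V K) (i : V) : ℝ := (q.count i : ℝ) + √(K : ℝ)

/-- The mirror map potential, whose gradient is the vector of congestion costs. -/
def mirror (q : State V K) : ℝ :=
  -(2 * √((Fintype.card V : ℝ) * shiftedMass V K)) * ∑ i, √(q.shifted i)

theorem sqrt_le_shifted (q : State V K) (i : V) : √(K : ℝ) ≤ q.shifted i := by
  simp [shifted]

theorem shifted_pos (hK : 0 < K) (q : State V K) (i : V) : 0 < q.shifted i :=
  (Real.sqrt_pos.2 (by exact_mod_cast hK)).trans_le (q.sqrt_le_shifted i)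

theorem sum_shifted (q : State V K) : ∑ i, q.shifted i = shiftedMass V K := by
  simp [shifted, shiftedMass, Finset.sum_add_distrib, q.sum_count_real]

theorem cost_eq (hK : 0 < K) (q : State V K) (i : V) :
    q.cost i = -(√((Fintype.card V : ℝ) * shiftedMass V K) / √(q.shifted i)) := by
  have hx := q.shifted_pos hK i
  have hM : 0 ≤ shiftedMass V K := by unfold shiftedMass; positivity
  change congestion _ (q.shifted i / shiftedMass V K) = _
  rw [congestion, Real.rpow_neg (by positivity), ← Real.sqrt_eq_rpow, Real.sqrt_div hx.le,
    Real.sqrt_mul (Nat.cast_nonneg _), inv_div]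
  ring

theorem mirror_nonpos (q : State V K) : q.mirror ≤ 0 := by
  rw [mirror, neg_mul, neg_nonpos]
  positivity

/-- Cauchy–Schwarz bounds the sum of the square roots. -/
theorem neg_le_mirror (q : State V K) :
    -(2 * (Fintype.card V : ℝ) * shiftedMass V K) ≤ q.mirror := by
  have hM : 0 ≤ shiftedMass V K := by unfold shiftedMass; positivity
  have h : ∑ i, √(q.shifted i) ≤ √((Fintype.card V : ℝ) * shiftedMass V K) := by
    refine Real.le_sqrt_of_sq_le ?_
    have := sq_sum_le_card_mul_sum_sq (s := Finset.univ) (f := fun i => √(q.shifted i))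
    rw [Finset.card_univ] at this
    refine this.trans (le_of_eq ?_)
    rw [← q.sum_shifted]
    congr 1
    exact Finset.sum_congr rfl fun i _ => Real.sq_sqrt (by unfold shifted; positivity)
  have h2 := Real.mul_self_sqrt (mul_nonneg (Nat.cast_nonneg (Fintype.card V)) hM)
  have h3 := mul_le_mul_of_nonneg_left h (Real.sqrt_nonneg ((Fintype.card V : ℝ) * shiftedMass V K))
  rw [mirror]
  linarith

/-- A transfer changes the potential by the cost difference, up to second-order terms. -/
theorem mirror_move_le [DecidableEq V] (hK : 0 < K) (q : State V K) {j k : V} (hjk : k ≠ j)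
    (hj : 0 < q.count j) :
    (q.move j k).mirror ≤ q.mirror - q.cost j + q.cost k +
      (-q.cost j) / q.shifted j + (-q.cost k) / q.shifted k := by
  have hmv := q.sum_move hjk hj fun _ n => √((n : ℝ) + √(K : ℝ))
  rw [Nat.cast_sub hj] at hmv
  have hxj : 1 ≤ q.shifted j := by
    have : (1 : ℝ) ≤ q.count j := by exact_mod_cast hj
    unfold shifted
    linarith [Real.sqrt_nonneg (K : ℝ)]
  have hxk := q.shifted_pos hK k
  have e1 : ((q.count j : ℝ) - (1 : ℕ)) + √(K : ℝ) = q.shifted j - 1 := by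
    unfold shifted; push_cast; ring
  have e2 : ((q.count k + 1 : ℕ) : ℝ) + √(K : ℝ) = q.shifted k + 1 := by
    unfold shifted; push_cast; ring
  rw [e1, e2] at hmv
  change ∑ i, √((q.move j k).shifted i) = ∑ i, √(q.shifted i) +
    (√(q.shifted j - 1) - √(q.shifted j)) + (√(q.shifted k + 1) - √(q.shifted k)) at hmv
  have h1 := two_mul_sqrt_sub_sqrt_sub_one_le hxj
  have h2 := le_two_mul_sqrt_add_one_sub_sqrt hxk
  rw [cost_eq hK, cost_eq hK, mirror, mirror, hmv]
  set B := √((Fintype.card V : ℝ) * shiftedMass V K)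
  have hB : 0 ≤ B := Real.sqrt_nonneg _
  have h3 := mul_le_mul_of_nonneg_left h1 hB
  have h4 := mul_le_mul_of_nonneg_left h2 hB
  -- The Taylor remainders, scaled by `B`, are exactly the terms `-cost / shifted`.
  have e3 : -(-(B / √(q.shifted j))) / q.shifted j = B * (1 / (q.shifted j * √(q.shifted j))) := by
    rw [neg_neg, div_div, mul_comm (√_), mul_one_div]
  have e4 : -(-(B / √(q.shifted k))) / q.shifted k = B * (1 / (q.shifted k * √(q.shifted k))) := by
    rw [neg_neg, div_div, mul_comm (√_), mul_one_div]
  have e5 : B / √(q.shifted j) = B * (1 / √(q.shifted j)) := by ring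
  have e6 : B / √(q.shifted k) = B * (1 / √(q.shifted k)) := by ring
  rw [e3, e4, e5, e6]
  linarith

end State

/-! ### Mirror backpressure against the dual -/

namespace System

variable {V S : Type*} [Fintype V] [DecidableEq V] {M : System V S} {K : ℕ}

/-- In every state, mirror backpressure collects the score of the current costs, up to the
second-order terms and the requests lost because the requestor has no scrip. -/
theorem score_sub_le_of_isMBP (hK : 0 < K) (hw : ∀ τ, |M.payoff τ| ≤ 1) {π : M.Policy K}
    (hπ : π.IsMBP) (t : ℕ) (h : M.History K t) (q : State V K) (τ : M.types) {b : V}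
    (hb : ∀ i, q.count b ≤ q.count i) :
    M.score q.cost τ - 2 * (-q.cost b / q.shifted b) - (if q.count b = 0 then 1 else 0) ≤
      expect (π.decision t h q τ) fun a =>
        M.reward τ a + q.mirror - (M.nextState q τ a).mirror := by
  have hxb := q.shifted_pos hK b
  have hsh : ∀ i, q.shifted b ≤ q.shifted i := fun i => by
    have : (q.count b : ℝ) ≤ q.count i := by exact_mod_cast hb i
    unfold State.shifted
    linarith
  have hcost : ∀ i, q.cost b ≤ q.cost i := fun i => by
    rw [State.cost_eq hK, State.cost_eq hK, neg_le_neg_iff]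
    exact div_le_div_of_nonneg_left (Real.sqrt_nonneg _) (Real.sqrt_pos.2 hxb)
      (Real.sqrt_le_sqrt (hsh i))
  have hcost0 : ∀ i, q.cost i ≤ 0 := fun i => by
    rw [State.cost_eq hK, neg_nonpos]
    positivity
  have herr : ∀ i, -q.cost i / q.shifted i ≤ -q.cost b / q.shifted b := fun i =>
    div_le_div₀ (by linarith [hcost0 b]) (by linarith [hcost i]) hxb (hsh i)
  have herr0 : 0 ≤ -q.cost b / q.shifted b := div_nonneg (by linarith [hcost0 b]) hxb.le
  obtain ⟨k, hk, hkmin, hdec⟩ := hπ t h q τ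
  have hZ : (0 : ℝ) ≤ if q.count b = 0 then 1 else 0 := by split_ifs <;> norm_num
  rw [hdec, expect_pure]
  have hmin : (M.providers τ).inf' (M.providers_nonempty τ) q.cost = M.minCost q τ := rfl
  rw [score, hmin, ← hkmin]
  by_cases h1 : 0 ≤ M.payoff τ + q.cost (M.requestor τ) - q.cost k ∧ 0 < q.count (M.requestor τ)
  · have hmv := q.mirror_move_le hK (provider_ne τ hk) h1.2
    rw [if_pos h1, max_eq_right h1.1]
    simp only [reward, nextState]
    linarith [herr k, herr (M.requestor τ)]
  · rw [if_neg h1]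
    simp only [reward, nextState]
    rcases le_total (M.payoff τ + q.cost (M.requestor τ) - q.cost k) 0 with h3 | h3
    · rw [max_eq_left h3]
      linarith
    · have h4 : q.count (M.requestor τ) = 0 := by
        by_contra h5
        exact h1 ⟨h3, Nat.pos_of_ne_zero h5⟩
      have h5 : q.count b = 0 := Nat.le_zero.1 (h4 ▸ hb _)
      -- An empty requestor has the least cost, so the score lost is at most the payoff, hence at
      -- most one.
      have h6 : q.cost (M.requestor τ) ≤ q.cost k := by
        have h7 : q.shifted (M.requestor τ) ≤ q.shifted k := by simp [State.shifted, h4]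
        rw [State.cost_eq hK, State.cost_eq hK, neg_le_neg_iff]
        exact div_le_div_of_nonneg_left (Real.sqrt_nonneg _)
          (Real.sqrt_pos.2 (q.shifted_pos hK _)) (Real.sqrt_le_sqrt h7)
      have := (abs_le.1 (hw τ)).2
      rw [max_eq_right h3, if_pos h5]
      linarith

/-- The dual value at the current costs dominates the optimum, net of the losses of mirror
backpressure. -/
theorem iInf_dualValue_le_cost (hw : ∀ τ, |M.payoff τ| ≤ 1) (hα : 0 < M.connectedness)
    (hα1 : M.connectedness ≤ 1) (hK : 0 < K)
    (hKs : 16 * (Fintype.card V : ℝ) ≤ M.connectedness ^ 2 * √(K : ℝ)) (q : State V K) (b : V) :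
    (⨅ y, M.dualValue y) - 128 * (Fintype.card V : ℝ) ^ 2 * (1 / (K : ℝ)) ≤
      M.dualValue q.cost - 2 * (-q.cost b / q.shifted b) -
        (if q.count b = 0 then 1 else 0) := by
  have hK' : (0 : ℝ) < K := by exact_mod_cast hK
  have hs : 0 < √(K : ℝ) := Real.sqrt_pos.2 hK'
  have hss : √(K : ℝ) * √(K : ℝ) = K := Real.mul_self_sqrt hK'.le
  have hm : (1 : ℝ) ≤ Fintype.card V := by
    exact_mod_cast Fintype.card_pos_iff.2 ⟨b⟩
  have hx := q.shifted_pos hK b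
  have hxs := q.sqrt_le_shifted b
  -- The richest agent holds at least the average shifted count, which makes its cost at least `-m`.
  obtain ⟨a, ha⟩ : ∃ a, shiftedMass V K ≤ Fintype.card V * q.shifted a := by
    obtain ⟨a, -, ha⟩ := Finset.exists_max_image Finset.univ q.shifted ⟨b, Finset.mem_univ b⟩
    refine ⟨a, ?_⟩
    rw [← q.sum_shifted]
    exact (Finset.sum_le_card_nsmul _ _ _ ha).trans (by simp)
  have hxa := q.shifted_pos hK a
  have hcb := q.cost_eq hK b
  have hca := q.cost_eq hK a
  have hN : 0 < shiftedMass V K := by unfold shiftedMass; positivity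
  have hNK : (K : ℝ) ≤ shiftedMass V K := by
    unfold shiftedMass
    linarith [mul_pos (lt_of_lt_of_le one_pos hm) hs]
  have hcount : q.count b = 0 → q.shifted b = √(K : ℝ) := fun h => by simp [State.shifted, h]
  have hNs : shiftedMass V K = √(K : ℝ) * (√(K : ℝ) + Fintype.card V) := by
    unfold shiftedMass
    linear_combination -hss
  set m : ℝ := (Fintype.card V : ℝ)
  set s := √(K : ℝ)
  set N := shiftedMass V K
  set x := q.shifted b
  set α := M.connectedness
  set r := √(m * N) / √x with hr
  have hr0 : 0 < r := by positivity
  have hrx : r ^ 2 * x = m * N := by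
    rw [hr, div_pow, Real.sq_sqrt (by positivity), Real.sq_sqrt hx.le, div_mul_cancel₀ _ hx.ne']
  have hca' : -m ≤ q.cost a := by
    rw [hca, neg_le_neg_iff, ← Real.sqrt_div (by positivity)]
    refine Real.sqrt_le_iff.2 ⟨by linarith, ?_⟩
    rw [div_le_iff₀ hxa]
    nlinarith
  rw [hcb, neg_neg]
  have hα2 : α ^ 2 ≤ α := by nlinarith
  have hs16 : 16 * m ≤ s := by nlinarith
  have hαs : 16 * m ≤ α * s := hKs.trans (mul_le_mul_of_nonneg_right hα2 hs.le)
  -- Here `r` is minus the cost of the poorest agent, so the spread is at least `r - m`. It exceeds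
  -- `m * (δ + 1)` with `δ = r / (2 * m)` exactly when `r > 4 * m`.
  rcases le_or_gt r (4 * m) with hcase | hcase
  -- An empty agent would have `r² = m * (s + m) ≥ 17 * m²`, contradicting `r ≤ 4 * m`.
  · have hZ : q.count b ≠ 0 := by
      intro h0
      have hxs' := hcount h0
      have h1 : r ^ 2 = m * (s + m) := by
        have : r ^ 2 * s = m * (s + m) * s := by rw [← hxs', hrx, hNs, hxs']; ring
        exact mul_right_cancel₀ hs.ne' this
      have h2 : r ^ 2 ≤ (4 * m) ^ 2 := by gcongr
      nlinarith
    -- From `r² * x = m * N`, the loss is `2 * r³ / (m * N)`; `128` is `2 * 4³`.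
    have h2 : 2 * (r / x) ≤ 128 * m ^ 2 * (1 / K) := by
      have h3 : r / x = r ^ 3 / (m * N) := by
        rw [← hrx]
        field_simp
      have h4 : r ^ 3 ≤ (4 * m) ^ 3 := by gcongr
      calc 2 * (r / x) ≤ 2 * ((4 * m) ^ 3 / (m * N)) := by rw [h3]; gcongr
        _ = 128 * m ^ 2 * (1 / N) := by field_simp; ring
        _ ≤ _ := by gcongr
    rw [if_neg hZ]
    linarith [M.iInf_dualValue_le q.cost]
  -- The dual excess `α * r / (2 * m)` is split in half: one half pays the second-order loss, the
  -- other the empty requestor.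
  · have hgap := iInf_dualValue_add_le hw q.cost (δ := r / (2 * m)) (by positivity) a b (by
      have : m * (r / (2 * m) + 1) = r / 2 + m := by field_simp
      rw [this, hcb]
      linarith)
    have h1 : 2 * (r / x) ≤ α * (r / (4 * m)) := by
      have h3 : r / x ≤ r / s := by gcongr
      have h4 : α * (r / (4 * m)) - 2 * (r / s) = r * (α * s - 8 * m) / (4 * m * s) := by
        field_simp
        ring
      have h5 : 0 ≤ r * (α * s - 8 * m) / (4 * m * s) :=
        div_nonneg (mul_nonneg hr0.le (by linarith)) (by positivity)
      linarith
    have h2 : (if q.count b = 0 then (1 : ℝ) else 0) ≤ α * (r / (4 * m)) := by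
      split_ifs with h0
      · have hxs' := hcount h0
        have h3 : r ^ 2 = m * (s + m) := by
          have : r ^ 2 * s = m * (s + m) * s := by rw [← hxs', hrx, hNs, hxs']; ring
          exact mul_right_cancel₀ hs.ne' this
        -- After squaring, `α² * s ≥ 16 * m` suffices; this is where the square of the connectedness
        -- enters.
        have h4 : 4 * m ≤ α * r := by
          refine (sq_le_sq₀ (by positivity) (by positivity)).1 ?_
          rw [mul_pow α r, h3]
          nlinarith [mul_le_mul_of_nonneg_left hKs (by linarith : 0 ≤ m), sq_nonneg (α * m)]
        rw [← mul_div_assoc, le_div_iff₀ (by positivity)]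
        linarith
      · positivity
    have h3 : α * (r / (2 * m)) = α * (r / (4 * m)) + α * (r / (4 * m)) := by
      field_simp
      ring
    have h4 : 0 ≤ 128 * m ^ 2 * (1 / (K : ℝ)) := by positivity
    linarith

theorem le_averagePayoff_of_isMBP (hw : ∀ τ, |M.payoff τ| ≤ 1) (hα : 0 < M.connectedness)
    (hα1 : M.connectedness ≤ 1) (hK : 0 < K)
    (hKs : 16 * (Fintype.card V : ℝ) ≤ M.connectedness ^ 2 * √(K : ℝ)) {π : M.Policy K}
    (hπ : π.IsMBP) {T : ℕ} (hT : 1 ≤ T) (q₀ : State V K) :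
    (⨅ y, M.dualValue y) - 128 * (Fintype.card V : ℝ) ^ 2 * (1 / (K : ℝ)) -
      4 * Fintype.card V * K / T ≤ averagePayoff π T q₀ := by
  have hs : 0 < √(K : ℝ) := Real.sqrt_pos.2 (by exact_mod_cast hK)
  have hN : shiftedMass V K ≤ 2 * K := by
    have hss : √(K : ℝ) * √(K : ℝ) = K := Real.mul_self_sqrt (Nat.cast_nonneg K)
    have : (Fintype.card V : ℝ) ≤ √(K : ℝ) := by
      have : M.connectedness ^ 2 ≤ 1 := by nlinarith
      nlinarith [(Nat.cast_nonneg _ : (0 : ℝ) ≤ Fintype.card V)]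
    unfold shiftedMass
    nlinarith
  refine le_averagePayoff_of_drift π q₀ State.mirror hT ?_ ?_
  · intro t h q
    obtain ⟨i, -⟩ : ∃ i, q.count i ≠ 0 := by
      by_contra! hcon
      have := q.total
      simp [hcon] at this
      omega
    have : Nonempty V := ⟨i⟩
    obtain ⟨b, hb⟩ := Finite.exists_min q.count
    refine (iInf_dualValue_le_cost hw hα hα1 hK hKs q b).trans ?_
    have := expect_mono M.arrival fun τ => score_sub_le_of_isMBP hK hw hπ t h q τ hb
    rw [expect_sub, expect_sub, expect_const, expect_const] at this
    exact this
  -- `mirror` ranges within `[-2 * m * N, 0]`, and `N ≤ 2 * K`.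
  · intro q q'
    have h1 := q.mirror_nonpos
    have h2 := q'.neg_le_mirror
    have h3 := mul_le_mul_of_nonneg_left hN (by positivity : 0 ≤ 2 * (Fintype.card V : ℝ))
    linarith

end System

end Scrip

/-! ### From payoff bounds to optimality gaps -/

namespace Scrip.System

variable {V S : Type*} [Fintype V] [DecidableEq V] {M : System V S} {K : ℕ}

/-- Two-sided bounds on average payoffs, of the kind that hold for mirror backpressure, bound the
optimality gaps. -/
theorem loss_le_of_averagePayoff_bounds [Nonempty (State V K)] {π : M.Policy K} {w a b e : ℝ}
    (hupper : ∀ (π' : M.Policy K) (T : ℕ) (q : State V K), 1 ≤ T →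
      averagePayoff π' T q ≤ w + a / T)
    (hlower : ∀ (T : ℕ) (q : State V K), 1 ≤ T → w - e - b / T ≤ averagePayoff π T q) :
    (∀ T : ℕ, 1 ≤ T → finiteLoss π T ≤ (a + b) / T + e) ∧ longRunLoss π ≤ e := by
  have : Nonempty (M.Policy K) := ⟨π⟩
  have hopt : ∀ T : ℕ, 1 ≤ T → optFinitePayoff M K T ≤ w + a / T := fun T hT =>
    ciSup_le fun π' => ciSup_le fun q => hupper π' T q hT
  have hfin : ∀ T : ℕ, 1 ≤ T → w - e - b / T ≤ finitePayoff π T := fun T hT =>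
    le_ciInf fun q => hlower T q hT
  -- This supplies the opposite bounds on the two payoff sequences, without which the real `limsup`
  -- and `liminf` could take default values.
  have hle : ∀ T : ℕ, 1 ≤ T → finitePayoff π T ≤ optFinitePayoff M K T := fun T hT => by
    obtain ⟨q⟩ := ‹Nonempty (State V K)›
    have h1 : finitePayoff π T ≤ averagePayoff π T q :=
      ciInf_le (Set.finite_range _).bddBelow q
    have h2 : averagePayoff π T q ≤ ⨆ q₀ : State V K, averagePayoff π T q₀ :=
      le_ciSup (f := fun q₀ => averagePayoff π T q₀) (Set.finite_range _).bddAbove q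
    have h3 : (⨆ q₀ : State V K, averagePayoff π T q₀) ≤ optFinitePayoff M K T := by
      refine le_ciSup (f := fun π' : M.Policy K => ⨆ q₀ : State V K, averagePayoff π' T q₀)
        ⟨w + a / T, ?_⟩ π
      rintro _ ⟨π', rfl⟩
      exact ciSup_le fun q => hupper π' T q hT
    exact h1.trans (h2.trans h3)
  refine ⟨fun T hT => ?_, ?_⟩
  · rw [finiteLoss, add_div]
    linarith [hopt T hT, hfin T hT]
  · have hu : Tendsto (fun T : ℕ => w + a / (T : ℝ)) atTop (nhds w) := by
      simpa using (tendsto_const_div_atTop_nhds_zero_nat a).const_add w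
    have hl : Tendsto (fun T : ℕ => w - e - b / (T : ℝ)) atTop (nhds (w - e)) := by
      simpa using (tendsto_const_div_atTop_nhds_zero_nat b).const_sub (w - e)
    have hev : ∀ {p : ℕ → Prop}, (∀ T, 1 ≤ T → p T) → ∀ᶠ T in atTop, p T := fun h =>
      (eventually_ge_atTop 1).mono h
    have hoptlow : ∀ T : ℕ, 1 ≤ T → w - e - b / T ≤ optFinitePayoff M K T := fun T hT =>
      (hfin T hT).trans (hle T hT)
    have hfinup : ∀ T : ℕ, 1 ≤ T → finitePayoff π T ≤ w + a / T := fun T hT =>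
      (hle T hT).trans (hopt T hT)
    have h1 : optLongRunPayoff M K ≤ w := by
      rw [← hu.limsup_eq]
      exact limsup_le_limsup (hev hopt)
        (hl.isBoundedUnder_ge.mono_ge (hev hoptlow)).isCoboundedUnder_le hu.isBoundedUnder_le
    have h2 : w - e ≤ longRunPayoff π := by
      rw [← hl.liminf_eq]
      exact liminf_le_liminf (hev hfin) hl.isBoundedUnder_ge
        (hu.isBoundedUnder_le.mono_le (hev hfinup)).isCoboundedUnder_ge
    rw [longRunLoss]
    linarith

end Scrip.System

end

theorem mainTheorem6 :
    ∃ C : ℝ, 0 < C ∧ ∃ P : MvPolynomial (Fin 2) ℝ,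
      ∀ (V S : Type*) [Fintype V] [DecidableEq V] [Fintype S] (M : Scrip.System V S),
        IsGreatest (Set.range fun τ : M.types => |M.payoff τ|) 1 →
        0 < M.connectedness →
        ∀ K : ℕ, MvPolynomial.eval ![(Fintype.card V : ℝ), 1 / M.connectedness] P ≤ (K : ℝ) →
          ∀ π : M.Policy K, π.IsMBP →
            (∀ T : ℕ, 1 ≤ T →
              Scrip.System.finiteLoss π T ≤
                C * (Fintype.card V : ℝ) * ((K : ℝ) / (T : ℝ)) +
                  C * (Fintype.card V : ℝ) ^ 2 * (1 / (K : ℝ))) ∧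
            Scrip.System.longRunLoss π ≤ C * (Fintype.card V : ℝ) ^ 2 * (1 / (K : ℝ)) := by
  -- The polynomial `256 * m² / α⁴` is the square of `16 * m / α²`, the required lower bound on
  -- `√K`. The constant `128` comes from the second-order loss; the transient terms need only `1 + 4
  -- = 5`.
  refine ⟨128, by norm_num,
    MvPolynomial.C 256 * MvPolynomial.X 0 ^ 2 * MvPolynomial.X 1 ^ 4, ?_⟩
  intro V S _ _ _ M hM hα K hP π hπ
  have hw : ∀ τ, |M.payoff τ| ≤ 1 := fun τ => hM.2 ⟨τ, rfl⟩
  obtain ⟨τ, -⟩ := hM.1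
  have hα1 := Scrip.System.connectedness_le_one τ
  have : Nonempty V := ⟨M.requestor τ⟩
  have hm : (0 : ℝ) < Fintype.card V := by exact_mod_cast Fintype.card_pos
  simp only [map_mul, map_pow, MvPolynomial.eval_C, MvPolynomial.eval_X, Matrix.cons_val_zero,
    Matrix.cons_val_one] at hP
  have hK : 0 < K := by
    have : (0 : ℝ) < K := lt_of_lt_of_le (by positivity) hP
    exact_mod_cast this
  have hKs : 16 * (Fintype.card V : ℝ) ≤ M.connectedness ^ 2 * √(K : ℝ) := by
    have h1 : 16 * (Fintype.card V : ℝ) * (1 / M.connectedness) ^ 2 ≤ √(K : ℝ) :=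
      Real.le_sqrt_of_sq_le (le_trans (le_of_eq (by ring)) hP)
    rw [one_div, inv_pow, ← div_eq_mul_inv, div_le_iff₀ (by positivity)] at h1
    linarith
  have : Nonempty (Scrip.State V K) :=
    ⟨⟨Pi.single (M.requestor τ) K, by simp⟩⟩
  obtain ⟨h1, h2⟩ := Scrip.System.loss_le_of_averagePayoff_bounds (π := π)
    (fun π' T q hT => Scrip.System.averagePayoff_le_iInf_dualValue hw π' q hT)
    (fun T q hT => Scrip.System.le_averagePayoff_of_isMBP hw hα hα1 hK hKs hπ hT q)
  refine ⟨fun T hT => (h1 T hT).trans ?_, h2⟩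
  have h3 : 0 ≤ (Fintype.card V : ℝ) * ((K : ℝ) / T) := by positivity
  have h4 : ((Fintype.card V : ℝ) * K + 4 * Fintype.card V * K) / T =
      5 * (Fintype.card V * (K / T)) := by ring
  rw [h4]
  linarith
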